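/- Let $\mathcal{F}_2$ be the free group of rank $2$. Let $\mathcal{AF}_2$ be the graph whose vertices are the nontrivial proper free factors of $\mathcal{F}_2$, two distinct vertices being joined by an edge $E(x,y)$ if $\mathcal{F}_2$ is the internal free product of $x$ and $y$. For a vertex $x$ let $D_1(x)$ be the set of vertices at distance exactly $1$ from $x$, i.e. its set of neighbours. Say that a vertex $x$ is a $1$-conjugate of a vertex $y$, written $C(x,y)$, if there is a basis $\{g,z\}$ of $\mathcal{F}_2$ such that $x=\langle g\rangle$ and $y=\langle g^z\rangle$, where $g^z=z^{-1}gz$. Then for any two distinct vertices $x,y$ of $\mathcal{AF}_2$ the following are equivalent: 1. $x$ is a $1$-conjugate of $y$; 2. $D_1(x)\cap D_1(y)$ is infinite; 3. $|D_1(x)\cap D_1(y)|\geq 5$. Moreover, the binary relation $C$ on $\mathcal{AF}_2$ is definable without parameters by a first-order formula in the language of graphs $L_0=\{E\}$. -/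

import Mathlib

/-- The free group of rank two. -/
abbrev F2 : Type := FreeGroup (Fin 2)

/-- `G` is the (internal) free product of its subgroups `H` and `K`: the canonical homomorphism
from the free product `H ∗ K` to `G` is an isomorphism. -/
def IsInternalFreeProduct {G : Type*} [Group G] (H K : Subgroup G) : Prop :=
  Function.Bijective (Monoid.Coprod.lift H.subtype K.subtype)

theorem IsInternalFreeProduct.symm {G : Type*} [Group G] {H K : Subgroup G}
    (h : IsInternalFreeProduct H K) : IsInternalFreeProduct K H := by
  have e : Monoid.Coprod.lift K.subtype H.subtype =
      (Monoid.Coprod.lift H.subtype K.subtype).comp (Monoid.Coprod.swap K H) :=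
    Monoid.Coprod.hom_ext rfl rfl
  unfold IsInternalFreeProduct at h ⊢
  rw [e, MonoidHom.coe_comp]
  exact h.comp Monoid.Coprod.swap_bijective

/-- `H` is a free factor of `G`: it has a complement with respect to free products. -/
def IsFreeFactor {G : Type*} [Group G] (H : Subgroup G) : Prop :=
  ∃ K : Subgroup G, IsInternalFreeProduct H K

/-- The vertices of the free factor complex of `F2`: the nontrivial proper free factors. -/
def AF2 : Type := {H : Subgroup F2 // IsFreeFactor H ∧ H ≠ ⊥ ∧ H ≠ ⊤}

namespace AF2

/-- The edge relation `E` of the free factor complex: two distinct vertices are adjacent when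
they generate `F2` as a free product. -/
def graph : SimpleGraph AF2 where
  Adj x y := x ≠ y ∧ IsInternalFreeProduct x.1 y.1
  symm := ⟨fun _ _ h => ⟨h.1.symm, h.2.symm⟩⟩
  loopless := ⟨fun _ h => h.1 rfl⟩

/-- `AF2` as a structure in the language with one binary relation symbol, interpreted as `E`. -/
instance : FirstOrder.Language.graph.Structure AF2 := graph.structure

/-- `D k x` is the set of vertices `y` such that `k` is the minimal length of a path
from `x` to `y`. -/
def D (k : ℕ) (x : AF2) : Set AF2 := {y | graph.edist x y = k}

/-- The relation `C`: `x` is a 1-conjugate of `y` if there is a basis `{g, z}` of `F2` such that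
`x` is generated by `g` and `y` is generated by the conjugate `z⁻¹ * g * z`. -/
def C (x y : AF2) : Prop :=
  ∃ b : FreeGroupBasis (Fin 2) F2,
    x.1 = Subgroup.zpowers (b 0) ∧ y.1 = Subgroup.zpowers ((b 1)⁻¹ * b 0 * b 1)

end AF2

/-! Every vertex is cyclic, and adjacent vertices are generated by the two elements of a basis. If
`{a, b}` is a basis, the neighbours of `⟨a⟩` are the `⟨a ^ p * b * a ^ q⟩`
(`exists_eq_zpow_mul_mul_zpow_of_mem_closure`, by counting letters in reduced words). If `x = ⟨g⟩`
and `y = ⟨z⁻¹ * g * z⟩`, all the `⟨g ^ n * z⟩` are common neighbours, so there are infinitely many.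
Conversely, let `x = ⟨a⟩` and `y ≠ x` have a common neighbour `⟨b⟩`, so that `y = ⟨b ^ m * a * b ^
n⟩`. If `m + n = 0`, then `|m| = 1` makes `x` a 1-conjugate of `y`, and `|m| ≥ 2` leaves only `⟨b⟩`.
If `m + n ≠ 0`, abelianizing shows that a common neighbour `⟨a ^ p * b * a ^ q⟩` satisfies `(p + q)
* (m + n) ∈ {0, 2}`; each value fixes `p + q` and allows at most two neighbours, hence at most four
in all. The last counts are read off from an action of `F2` on integer sequences. Having five
distinct common neighbours is first-order, which gives definability. -/

namespace FreeGroup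

/-! ### Reduced words and complements of a basis element -/

/-- A nonempty word whose first and last letters are the generator `1` or its inverse. -/
structure IsOuterWord (L : List (Fin 2 × Bool)) : Prop where
  ne_nil : L ≠ []
  head : ∀ p ∈ L.head?, p.1 = 1
  last : ∀ p ∈ L.getLast?, p.1 = 1

theorem fst_eq_of_mem_toWord_of_zpow {α : Type*} [DecidableEq α] (x : α) (k : ℤ) :
    ∀ p ∈ (of x ^ k : FreeGroup α).toWord, p.1 = x := by
  obtain ⟨n, rfl | rfl⟩ := k.eq_nat_or_neg
  · rw [zpow_natCast, toWord_of_pow]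
    intro p hp
    rw [List.eq_of_mem_replicate hp]
  · rw [zpow_neg, zpow_natCast, toWord_inv, toWord_of_pow]
    intro p hp
    simp [invRev] at hp
    rw [hp.2]

theorem isReduced_append_append {L₁ L₂ L₃ : List (Fin 2 × Bool)} (h₁ : IsReduced L₁)
    (h₂ : IsReduced L₂) (h₃ : IsReduced L₃) (hne : L₂ ≠ [])
    (h₁₂ : ∀ p ∈ L₁.getLast?, ∀ q ∈ L₂.head?, p.1 ≠ q.1)
    (h₂₃ : ∀ p ∈ L₂.getLast?, ∀ q ∈ L₃.head?, p.1 ≠ q.1) :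
    IsReduced (L₁ ++ L₂ ++ L₃) := by
  unfold IsReduced at *
  rw [List.isChain_append, List.isChain_append]
  refine ⟨⟨h₁, h₂, fun p hp q hq h => absurd h (h₁₂ p hp q hq)⟩, h₃, fun p hp q hq h => ?_⟩
  rw [List.getLast?_append_of_ne_nil _ hne] at hp
  exact absurd h (h₂₃ p hp q hq)

theorem toWord_mul_mul_of_isReduced {α : Type*} [DecidableEq α] {x y z : FreeGroup α}
    (h : IsReduced (x.toWord ++ y.toWord ++ z.toWord)) :
    (x * y * z).toWord = x.toWord ++ y.toWord ++ z.toWord := by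
  conv_lhs => rw [← mk_toWord (x := x), ← mk_toWord (x := y), ← mk_toWord (x := z)]
  rw [mul_mk, mul_mk, toWord_mk, h.reduce_eq]

theorem toWord_zpow_mul_mul_zpow {g : FreeGroup (Fin 2)} (hg : IsOuterWord g.toWord) (i j : ℤ) :
    (of 0 ^ i * g * of 0 ^ j).toWord =
      (of 0 ^ i : FreeGroup (Fin 2)).toWord ++ g.toWord ++
        (of 0 ^ j : FreeGroup (Fin 2)).toWord := by
  apply toWord_mul_mul_of_isReduced
  refine isReduced_append_append isReduced_toWord isReduced_toWord isReduced_toWord hg.ne_nil ?_ ?_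
  · intro p hp q hq
    rw [fst_eq_of_mem_toWord_of_zpow 0 i p (List.mem_of_getLast? hp), hg.head q hq]
    decide
  · intro p hp q hq
    rw [fst_eq_of_mem_toWord_of_zpow 0 j q (List.mem_of_head? hq), hg.last p hp]
    decide

theorem IsOuterWord.toWord_mul_zpow_mul {g h : FreeGroup (Fin 2)} (hg : IsOuterWord g.toWord)
    (hh : IsOuterWord h.toWord) {k : ℤ} (hk : k ≠ 0) :
    (g * of 0 ^ k * h).toWord =
      g.toWord ++ (of 0 ^ k : FreeGroup (Fin 2)).toWord ++ h.toWord := by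
  apply toWord_mul_mul_of_isReduced
  refine isReduced_append_append isReduced_toWord isReduced_toWord isReduced_toWord ?_ ?_ ?_
  · rw [Ne, toWord_eq_nil_iff]
    exact fun h0 => of_ne_one (0 : Fin 2) ((IsMulTorsionFree.zpow_eq_one_iff_left hk).1 h0)
  · intro p hp q hq
    rw [fst_eq_of_mem_toWord_of_zpow 0 k q (List.mem_of_head? hq), hg.last p hp]
    decide
  · intro p hp q hq
    rw [fst_eq_of_mem_toWord_of_zpow 0 k p (List.mem_of_getLast? hp), hh.head q hq]
    decide

theorem IsOuterWord.append {L₁ L₂ L₃ : List (Fin 2 × Bool)} (h₁ : IsOuterWord L₁)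
    (h₃ : IsOuterWord L₃) : IsOuterWord (L₁ ++ L₂ ++ L₃) where
  ne_nil := by simp [h₁.ne_nil]
  head := by
    rw [List.append_assoc, List.head?_append_of_ne_nil _ h₁.ne_nil]
    exact h₁.head
  last := by
    rw [List.getLast?_append_of_ne_nil _ h₃.ne_nil]
    exact h₃.last

theorem IsOuterWord.inv {g : FreeGroup (Fin 2)} (hg : IsOuterWord g.toWord) :
    IsOuterWord g⁻¹.toWord where
  ne_nil := by
    rw [Ne, toWord_eq_nil_iff, inv_eq_one, ← toWord_eq_nil_iff]
    exact hg.ne_nil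
  head := by
    rw [toWord_inv, invRev, List.head?_reverse, List.getLast?_map]
    intro p hp
    obtain ⟨q, hq, rfl⟩ := Option.map_eq_some_iff.1 hp
    exact hg.last q hq
  last := by
    rw [toWord_inv, invRev, List.getLast?_reverse, List.head?_map]
    intro p hp
    obtain ⟨q, hq, rfl⟩ := Option.map_eq_some_iff.1 hp
    exact hg.head q hq

/-- Cyclic reduction writes `g` as `c * r * c⁻¹`; then `c * r ^ n * c⁻¹` is already reduced, so the
end letters persist and the length does not drop. -/
theorem IsOuterWord.pow {g : FreeGroup (Fin 2)} (hg : IsOuterWord g.toWord) {n : ℕ}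
    (hn : n ≠ 0) : IsOuterWord (g ^ n).toWord ∧ g.norm ≤ (g ^ n).norm := by
  obtain ⟨k, rfl⟩ := Nat.exists_eq_succ_of_ne_zero hn
  have hL := reduceCyclically.conj_conjugator_reduceCyclically g.toWord
  have hP := reduceCyclically.reduce_flatten_replicate_succ (isReduced_toWord (x := g)) k
  rw [← toWord_pow] at hP
  unfold norm
  rw [Nat.succ_eq_add_one, hP]
  set c := reduceCyclically.conjugator g.toWord
  set r := reduceCyclically g.toWord
  have hr : r ≠ [] := by
    intro hr
    apply hg.ne_nil
    rw [toWord_eq_nil_iff, ← mk_toWord (x := g), ← hL, hr, List.append_nil, ← mul_mk, ← inv_mk,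
      mul_inv_cancel]
  refine ⟨⟨by simp [hr], ?_, ?_⟩, ?_⟩
  · have := hg.head
    rw [← hL, List.head?_append_of_ne_nil _ (by simp [hr])] at this
    rw [List.replicate_succ, List.flatten_cons, ← List.append_assoc, List.append_assoc (c ++ r),
      List.head?_append_of_ne_nil _ (by simp [hr])]
    exact this
  · have := hg.last
    rw [← hL, List.append_assoc, List.getLast?_append_of_ne_nil _ (by simp [hr])] at this
    rw [List.replicate_succ', List.flatten_append, List.flatten_singleton, ← List.append_assoc,
      List.append_assoc (c ++ _), List.getLast?_append_of_ne_nil _ (by simp [hr])]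
    exact this
  · conv_lhs => rw [← hL]
    simp only [List.length_append, List.replicate_succ, List.flatten_cons]
    omega

theorem IsOuterWord.zpow {g : FreeGroup (Fin 2)} (hg : IsOuterWord g.toWord) {n : ℤ}
    (hn : n ≠ 0) : IsOuterWord (g ^ n).toWord ∧ g.norm ≤ (g ^ n).norm := by
  obtain ⟨k, rfl | rfl⟩ := n.eq_nat_or_neg
  · rw [zpow_natCast]
    exact hg.pow (by simpa using hn)
  · rw [zpow_neg, zpow_natCast, norm_inv_eq]
    obtain ⟨h₁, h₂⟩ := hg.pow (n := k) (by simpa using hn)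
    exact ⟨h₁.inv, h₂⟩

/-- Products `w ^ n₁ * a ^ k₁ * w ^ n₂ * ⋯ * w ^ nᵣ` with `a = of 0`, `r ≥ 1` and nonzero
exponents. -/
inductive IsAlternating (w : FreeGroup (Fin 2)) : FreeGroup (Fin 2) → Prop
  | base {n : ℤ} (hn : n ≠ 0) : IsAlternating w (w ^ n)
  | step {g : FreeGroup (Fin 2)} {k n : ℤ} (hg : IsAlternating w g) (hk : k ≠ 0) (hn : n ≠ 0) :
      IsAlternating w (g * of 0 ^ k * w ^ n)

/-- Nothing cancels between powers of `w` and powers of `a`, since the former begin and end with the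
other generator. -/
theorem IsAlternating.isOuterWord {w g : FreeGroup (Fin 2)} (hw : IsOuterWord w.toWord)
    (h : IsAlternating w g) : IsOuterWord g.toWord ∧ w.norm ≤ g.norm := by
  induction h with
  | base hn => exact hw.zpow hn
  | step hg hk hn ih =>
    have h := ih.1.toWord_mul_zpow_mul (hw.zpow hn).1 hk
    rw [norm, norm, h]
    refine ⟨ih.1.append (hw.zpow hn).1, ?_⟩
    have := ih.2
    unfold norm at this
    simp only [List.length_append]
    omega

theorem eq_zpow_or_isAlternating_mul {w g : FreeGroup (Fin 2)}
    (hg : (∃ k : ℤ, g = of 0 ^ k) ∨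
      ∃ (i j : ℤ) (h : FreeGroup (Fin 2)), IsAlternating w h ∧ g = of 0 ^ i * h * of 0 ^ j)
    {ε : ℤ} (hε : ε ≠ 0) :
    (∃ k : ℤ, g * w ^ ε = of 0 ^ k) ∨
      ∃ (i j : ℤ) (h : FreeGroup (Fin 2)),
        IsAlternating w h ∧ g * w ^ ε = of 0 ^ i * h * of 0 ^ j := by
  rcases hg with ⟨k, rfl⟩ | ⟨i, j, h, hh, rfl⟩
  · exact .inr ⟨k, 0, _, .base hε, by simp⟩
  · by_cases hj : j = 0
    · subst hj
      cases hh with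
      | @base n hn =>
        by_cases hs : n + ε = 0
        · exact .inl ⟨i, by rw [zpow_zero, mul_one, mul_assoc, ← zpow_add, hs]; simp⟩
        · exact .inr ⟨i, 0, _, .base hs, by
            rw [zpow_zero, mul_one, mul_one, mul_assoc, ← zpow_add]⟩
      | @step g' k n hg' hk hn =>
        -- When the last power of `w` cancels, the preceding `a ^ k` becomes the right-hand power of
        -- `a`.
        by_cases hs : n + ε = 0
        · refine .inr ⟨i, k, g', hg', ?_⟩
          rw [zpow_zero, mul_one, mul_assoc, mul_assoc _ (w ^ n), ← zpow_add, hs]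
          simp [mul_assoc]
        · refine .inr ⟨i, 0, _, .step hg' hk hs, ?_⟩
          rw [zpow_add]
          simp [mul_assoc]
    · exact .inr ⟨i, 0, _, .step hh hj hε, by simp [mul_assoc]⟩

theorem eq_zpow_or_isAlternating_of_mem_closure {w g : FreeGroup (Fin 2)}
    (hg : g ∈ Subgroup.closure {of 0, w}) :
    (∃ k : ℤ, g = of 0 ^ k) ∨
      ∃ (i j : ℤ) (h : FreeGroup (Fin 2)), IsAlternating w h ∧ g = of 0 ^ i * h * of 0 ^ j := by
  have haux : ∀ (g : FreeGroup (Fin 2)) (m : ℤ), ((∃ k : ℤ, g = of 0 ^ k) ∨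
      ∃ (i j : ℤ) (h : FreeGroup (Fin 2)), IsAlternating w h ∧ g = of 0 ^ i * h * of 0 ^ j) →
      ((∃ k : ℤ, g * of 0 ^ m = of 0 ^ k) ∨ ∃ (i j : ℤ) (h : FreeGroup (Fin 2)),
        IsAlternating w h ∧ g * of 0 ^ m = of 0 ^ i * h * of 0 ^ j) := by
    rintro g m (⟨k, rfl⟩ | ⟨i, j, h, hh, rfl⟩)
    · exact .inl ⟨k + m, (zpow_add _ _ _).symm⟩
    · exact .inr ⟨i, j + m, h, hh, by rw [zpow_add, mul_assoc]⟩
  induction hg using Subgroup.closure_induction_right with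
  | one => exact .inl ⟨0, by simp⟩
  | mul_right x hx y hy ih =>
    rcases hy with rfl | rfl
    · simpa using haux x 1 ih
    · simpa using eq_zpow_or_isAlternating_mul ih one_ne_zero
  | mul_inv_cancel x hx y hy ih =>
    rcases hy with rfl | rfl
    · simpa using haux x (-1) ih
    · simpa using eq_zpow_or_isAlternating_mul ih (neg_ne_zero.2 one_ne_zero)

theorem norm_le_one_of_mem_closure {w : FreeGroup (Fin 2)} (hw : IsOuterWord w.toWord)
    (h : of 1 ∈ Subgroup.closure {of 0, w}) : w.norm ≤ 1 := by
  rcases eq_zpow_or_isAlternating_of_mem_closure h with ⟨k, hk⟩ | ⟨i, j, g, hg, h1⟩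
  · have := fst_eq_of_mem_toWord_of_zpow (0 : Fin 2) k
    rw [← hk] at this
    simp at this
  · obtain ⟨h₁, h₂⟩ := hg.isOuterWord hw
    have := congrArg List.length (toWord_zpow_mul_mul_zpow h₁ i j)
    rw [← h1, toWord_of] at this
    unfold norm at *
    simp only [List.length_append, List.length_singleton] at this
    omega

/-- A shortest element of the double coset of `w` modulo powers of `a` works: an end letter `a` or
`a⁻¹` could be stripped. -/
theorem exists_eq_zpow_mul_mul_zpow_isOuterWord (w : FreeGroup (Fin 2)) :
    ∃ (i j : ℤ) (v : FreeGroup (Fin 2)), w = of 0 ^ i * v * of 0 ^ j ∧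
      (v = 1 ∨ IsOuterWord v.toWord) := by
  have hex : ∃ N : ℕ, ∃ (i j : ℤ) (v : FreeGroup (Fin 2)),
      w = of 0 ^ i * v * of 0 ^ j ∧ v.norm = N := ⟨_, 0, 0, w, by simp, rfl⟩
  classical
  obtain ⟨i, j, v, hv, hN⟩ := Nat.find_spec hex
  have hmin : ∀ (k l : ℤ) (u : FreeGroup (Fin 2)), v = of 0 ^ k * u * of 0 ^ l →
      v.norm ≤ u.norm := by
    intro k l u hu
    rw [hN]
    refine Nat.find_min' hex ⟨i + k, l + j, u, ?_, rfl⟩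
    rw [hv, hu, zpow_add, zpow_add]
    group
  have hletter : ∀ ε : Bool, ∃ k : ℤ, (mk [((0 : Fin 2), ε)]) = of 0 ^ k := by
    rintro (_ | _)
    · exact ⟨-1, by rw [zpow_neg_one]; rfl⟩
    · exact ⟨1, by rw [zpow_one]; rfl⟩
  refine ⟨i, j, v, hv, or_iff_not_imp_left.2 fun h1 => ⟨by rwa [Ne, toWord_eq_nil_iff], ?_, ?_⟩⟩
  · rintro ⟨x, ε⟩ hp
    by_contra hx
    obtain rfl : x = 0 := by have : x ≠ 1 := hx; omega
    obtain ⟨L, hL⟩ := List.head?_eq_some_iff.1 hp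
    obtain ⟨k, hk⟩ := hletter ε
    have := hmin k 0 (mk L) (by
      rw [← hk, mul_mk, zpow_zero, mul_one, List.singleton_append, ← hL, mk_toWord])
    have h2 := norm_mk_le (L₁ := L)
    have h3 : v.norm = L.length + 1 := by rw [norm, hL, List.length_cons]
    omega
  · rintro ⟨x, ε⟩ hp
    by_contra hx
    obtain rfl : x = 0 := by have : x ≠ 1 := hx; omega
    obtain ⟨L, hL⟩ := List.getLast?_eq_some_iff.1 hp
    obtain ⟨k, hk⟩ := hletter ε
    have := hmin 0 k (mk L) (by
      rw [← hk, zpow_zero, one_mul, mul_mk, ← hL, mk_toWord])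
    have h2 := norm_mk_le (L₁ := L)
    have h3 : v.norm = L.length + 1 := by
      rw [norm, hL, List.length_append, List.length_singleton]
    omega

/-- If `a = of 0` and `w` generate the free group on `a` and `b = of 1`, then `w` lies in the double
coset of `b` or `b⁻¹` with respect to the powers of `a`. -/
theorem exists_eq_zpow_mul_mul_zpow_of_mem_closure {w : FreeGroup (Fin 2)}
    (h : of 1 ∈ Subgroup.closure {of 0, w}) :
    ∃ i j ε : ℤ, (ε = 1 ∨ ε = -1) ∧ w = of 0 ^ i * of 1 ^ ε * of 0 ^ j := by
  obtain ⟨i, j, v, rfl, hv⟩ := exists_eq_zpow_mul_mul_zpow_isOuterWord w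
  have h0 : of (0 : Fin 2) ∈ Subgroup.closure {of 0, v} := Subgroup.subset_closure (by simp)
  have hle : Subgroup.closure {of 0, of 0 ^ i * v * of 0 ^ j} ≤
      Subgroup.closure {of (0 : Fin 2), v} := by
    rw [Subgroup.closure_le]
    rintro x (rfl | rfl)
    · exact h0
    · exact mul_mem (mul_mem (zpow_mem h0 i) (Subgroup.subset_closure (by simp))) (zpow_mem h0 j)
  have h1 := hle h
  rcases hv with rfl | hv
  · have hle' : Subgroup.closure {of (0 : Fin 2), 1} ≤ Subgroup.zpowers (of 0) := by
      rw [Subgroup.closure_le]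
      rintro x (rfl | rfl)
      · exact Subgroup.mem_zpowers _
      · exact one_mem _
    obtain ⟨k, hk⟩ := hle' h1
    have := fst_eq_of_mem_toWord_of_zpow (0 : Fin 2) k
    simp only at hk
    rw [hk] at this
    simp at this
  -- The word of `v` has a single letter, which is the generator `1` or its inverse.
  · have h2 := norm_le_one_of_mem_closure hv h1
    have h3 := hv.head
    have h4 := mk_toWord (x := v)
    have h5 := hv.ne_nil
    unfold norm at h2
    match hL : v.toWord with
    | [] => exact absurd hL h5
    | [(x, ε)] =>
      rw [hL] at h3 h4
      obtain rfl : x = 1 := h3 (x, ε) rfl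
      cases ε
      · exact ⟨i, j, -1, .inr rfl, by rw [← h4, zpow_neg_one]; rfl⟩
      · exact ⟨i, j, 1, .inl rfl, by rw [← h4, zpow_one]; rfl⟩
    | _ :: _ :: _ => rw [hL] at h2; simp at h2

end FreeGroup

/-! ### Ordered bases of the free group -/

/-- `{u, v}` is an ordered basis of the free group of rank two. -/
def IsBasisPair (u v : F2) : Prop :=
  ∃ b : FreeGroupBasis (Fin 2) F2, b 0 = u ∧ b 1 = v

namespace IsBasisPair

variable {u v w : F2}

theorem exists_hom {G : Type*} [Group G] (h : IsBasisPair u v) (x y : G) :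
    ∃ f : F2 →* G, f u = x ∧ f v = y := by
  obtain ⟨b, rfl, rfl⟩ := h
  exact ⟨b.lift ![x, y], by simp, by simp⟩

theorem hom_ext {G : Type*} [Group G] (h : IsBasisPair u v) {f g : F2 →* G} (hu : f u = g u)
    (hv : f v = g v) : f = g := by
  obtain ⟨b, rfl, rfl⟩ := h
  exact b.ext_hom f g (Fin.forall_fin_two.2 ⟨hu, hv⟩)

theorem map (h : IsBasisPair u v) (e : F2 ≃* F2) : IsBasisPair (e u) (e v) := by
  obtain ⟨b, rfl, rfl⟩ := h
  exact ⟨b.map e, by simp, by simp⟩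

theorem of_hom (h : IsBasisPair u v) (f g : F2 →* F2) (h₁ : g (f u) = u) (h₂ : g (f v) = v)
    (h₃ : f (g u) = u) (h₄ : f (g v) = v) : IsBasisPair (f u) (f v) :=
  h.map (f.toMulEquiv g (h.hom_ext h₁ h₂) (h.hom_ext h₃ h₄))

theorem symm (h : IsBasisPair u v) : IsBasisPair v u := by
  obtain ⟨f, hu, hv⟩ := h.exists_hom v u
  simpa [hu, hv] using h.of_hom f f (by simp [hu, hv]) (by simp [hu, hv]) (by simp [hu, hv])
    (by simp [hu, hv])

theorem inv_left (h : IsBasisPair u v) : IsBasisPair u⁻¹ v := by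
  obtain ⟨f, hu, hv⟩ := h.exists_hom u⁻¹ v
  simpa [hu, hv] using h.of_hom f f (by simp [hu]) (by simp [hv]) (by simp [hu]) (by simp [hv])

theorem inv_right (h : IsBasisPair u v) : IsBasisPair u v⁻¹ := h.symm.inv_left.symm

theorem zpow_mul_zpow (h : IsBasisPair u v) (i j : ℤ) : IsBasisPair u (u ^ i * v * u ^ j) := by
  obtain ⟨f, hu, hv⟩ := h.exists_hom u (u ^ i * v * u ^ j)
  obtain ⟨g, hu', hv'⟩ := h.exists_hom u (u ^ (-i) * v * u ^ (-j))
  simpa [hu, hv] using h.of_hom f g (by simp [hu, hu'])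
    (by simp only [hv, hv', hu', map_mul, map_zpow]; group) (by simp [hu, hu'])
    (by simp only [hv, hv', hu, map_mul, map_zpow]; group)

theorem conj (h : IsBasisPair u v) (g : F2) : IsBasisPair (g * u * g⁻¹) (g * v * g⁻¹) := by
  simpa using h.map (MulAut.conj g)

theorem closure_eq_top (h : IsBasisPair u v) : Subgroup.closure {u, v} = ⊤ := by
  obtain ⟨b, rfl, rfl⟩ := h
  have h1 := congrArg (Subgroup.map b.repr.symm.toMonoidHom) (FreeGroup.closure_range_of (Fin 2))
  rw [MonoidHom.map_closure, ← MonoidHom.range_eq_map,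
    MonoidHom.range_eq_top.2 b.repr.symm.surjective] at h1
  rw [← h1]
  congr 1
  rw [← Set.range_comp]
  ext x
  simp only [Set.mem_insert_iff, Set.mem_singleton_iff, Set.mem_range, Fin.exists_fin_two,
    eq_comm (a := x)]
  rfl

theorem exists_eq_zpow_mul_zpow (h : IsBasisPair u v) (h' : IsBasisPair u w) :
    ∃ i j ε : ℤ, (ε = 1 ∨ ε = -1) ∧ w = u ^ i * v ^ ε * u ^ j := by
  have htop := h'.closure_eq_top
  obtain ⟨b, rfl, rfl⟩ := h
  have h1 : FreeGroup.of 1 ∈ Subgroup.closure {FreeGroup.of 0, b.repr w} := by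
    have h2 : b 1 ∈ Subgroup.closure {b 0, w} := htop ▸ Subgroup.mem_top _
    have h3 := Subgroup.mem_map_of_mem b.repr.toMonoidHom h2
    rw [MonoidHom.map_closure, Set.image_pair] at h3
    simpa using h3
  obtain ⟨i, j, ε, hε, h2⟩ := FreeGroup.exists_eq_zpow_mul_mul_zpow_of_mem_closure h1
  refine ⟨i, j, ε, hε, b.repr.injective ?_⟩
  simpa using h2

theorem ne_one_left (h : IsBasisPair u v) : u ≠ 1 := by
  rintro rfl
  obtain ⟨f, hu, -⟩ := h.exists_hom (Multiplicative.ofAdd (1 : ℤ)) 1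
  rw [map_one] at hu
  exact absurd hu (by decide)

theorem exists_exponent (h : IsBasisPair u v) (m n : ℤ) :
    ∃ f : F2 →* Multiplicative ℤ, f u = Multiplicative.ofAdd m ∧ f v = Multiplicative.ofAdd n :=
  h.exists_hom _ _

theorem notMem_zpowers (h : IsBasisPair u v) : v ∉ Subgroup.zpowers u := by
  rintro ⟨k, rfl⟩
  obtain ⟨f, hu, hv⟩ := h.exists_exponent 0 1
  simp only [map_zpow, hu, ofAdd_zero, one_zpow] at hv
  exact absurd hv (by decide)

end IsBasisPair

/-! ### Equations in the free group tested in the wreath product of `ℤ` by `ℤ` -/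

/-- The shift of an integer sequence by one place. -/
def shiftPerm : Equiv.Perm (ℤ → ℤ) where
  toFun f i := f (i - 1)
  invFun f i := f (i + 1)
  left_inv f := by simp
  right_inv f := by simp

/-- Adding one to the entry at `0` of an integer sequence. -/
def bumpPerm : Equiv.Perm (ℤ → ℤ) where
  toFun f i := f i + if i = 0 then 1 else 0
  invFun f i := f i - if i = 0 then 1 else 0
  left_inv f := by simp
  right_inv f := by simp

theorem shiftPerm_zpow_apply (p : ℤ) (f : ℤ → ℤ) (i : ℤ) : (shiftPerm ^ p) f i = f (i - p) := by
  induction p generalizing f i with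
  | zero => simp
  | succ p ih =>
    rw [zpow_add_one, Equiv.Perm.mul_apply, ih]
    change f (i - p - 1) = _
    congr 1; ring
  | pred p ih =>
    rw [zpow_sub_one, Equiv.Perm.mul_apply, ih]
    change f (i - -p + 1) = _
    congr 1; ring

theorem bumpPerm_zpow_apply (m : ℤ) (f : ℤ → ℤ) (i : ℤ) :
    (bumpPerm ^ m) f i = f i + if i = 0 then m else 0 := by
  induction m generalizing f i with
  | zero => simp
  | succ p ih =>
    rw [zpow_add_one, Equiv.Perm.mul_apply, ih]
    change f i + (if i = 0 then 1 else 0) + _ = _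
    split_ifs <;> ring
  | pred p ih =>
    rw [zpow_sub_one, Equiv.Perm.mul_apply, ih]
    change f i - (if i = 0 then 1 else 0) + _ = _
    split_ifs <;> ring

namespace IsBasisPair

variable {u v w : F2}

/-- Applied to the zero sequence, the left side puts `m` at `-d` and `n` at `1 - d`, the right side
`i` at `0` and `j` at `1`. -/
theorem eq_zero_or_of_zpow_conj_eq (h : IsBasisPair u v) {d m n i j : ℤ} (hmn : m + n ≠ 0)
    (heq : u ^ (-d) * (v ^ m * u * v ^ n) * u ^ d = v ^ i * u * v ^ j) :
    d = 0 ∨ (d = 1 ∧ m = 0) ∨ (d = -1 ∧ n = 0) := by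
  obtain ⟨f, hu, hv⟩ := h.exists_hom shiftPerm bumpPerm
  have key : ∀ t : ℤ, _ := fun t => congrFun (congrFun (congrArg DFunLike.coe
    (congrArg f heq)) (0 : ℤ → ℤ)) t
  -- Isolated factors `u` become powers, so that `shiftPerm_zpow_apply` covers them.
  rw [← zpow_one u] at key
  simp only [map_mul, map_zpow, hu, hv, Equiv.Perm.mul_apply, shiftPerm_zpow_apply,
    bumpPerm_zpow_apply, Pi.zero_apply, zero_add, ← zpow_mul, one_mul] at key
  have k0 := key 0
  have k1 := key 1
  have k2 := key (-d)
  have k3 := key (1 - d)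
  clear key
  grind

theorem eq_zero_of_zpow_conj_eq (h : IsBasisPair u v) {m p q i j ε : ℤ} (hε : ε = 1 ∨ ε = -1)
    (hm : 2 ≤ |m|)
    (heq : v ^ (-m) * (u ^ p * v * u ^ q) * v ^ m = u ^ i * v ^ ε * u ^ j) :
    p = 0 ∧ q = 0 := by
  obtain ⟨g, gu, gv⟩ := h.exists_exponent 0 1
  have e1 := congrArg (fun x => (g x).toAdd) heq
  simp [gu, gv] at e1
  subst e1
  rw [zpow_one] at heq
  -- On the zero sequence the left side adds `m` at `p + q`, `1` at `p` and `-m` at `0`; the right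
  -- side is a single `1` at `i`. As `|m| ≥ 2`, the entries `m` and `-m` must cancel.
  have hpq : p + q = 0 := by
    obtain ⟨f, hu, hv⟩ := h.exists_hom shiftPerm bumpPerm
    have key : ∀ t : ℤ, _ := fun t => congrFun (congrFun (congrArg DFunLike.coe
      (congrArg f heq)) (0 : ℤ → ℤ)) t
    rw [← zpow_one v] at key
    simp only [map_mul, map_zpow, hu, hv, Equiv.Perm.mul_apply, shiftPerm_zpow_apply,
      bumpPerm_zpow_apply, Pi.zero_apply, zero_add, ← zpow_mul, one_mul] at key
    have k0 := key 0
    have k1 := key p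
    have k2 := key (p + q)
    clear key
    grind
  -- With the roles exchanged, the left side has `p` at `-m`, outside the support `{0, 1}` of the
  -- right side.
  obtain ⟨f, hv, hu⟩ := h.symm.exists_hom shiftPerm bumpPerm
  have key : ∀ t : ℤ, _ := fun t => congrFun (congrFun (congrArg DFunLike.coe
    (congrArg f heq)) (0 : ℤ → ℤ)) t
  rw [← zpow_one v] at key
  simp only [map_mul, map_zpow, hu, hv, Equiv.Perm.mul_apply, shiftPerm_zpow_apply,
    bumpPerm_zpow_apply, Pi.zero_apply, zero_add, ← zpow_mul, one_mul] at key
  have k0 := key (-m)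
  clear key
  grind

end IsBasisPair

/-! ### Free factorizations and bases -/

theorem IsBasisPair.isInternalFreeProduct {u v : F2} (h : IsBasisPair u v) :
    IsInternalFreeProduct (Subgroup.zpowers u) (Subgroup.zpowers v) := by
  let U : Subgroup.zpowers u := ⟨u, Subgroup.mem_zpowers u⟩
  let V : Subgroup.zpowers v := ⟨v, Subgroup.mem_zpowers v⟩
  obtain ⟨f, hu, hv⟩ := h.exists_hom
    (Monoid.Coprod.inl U : Monoid.Coprod (Subgroup.zpowers u) (Subgroup.zpowers v))
    (Monoid.Coprod.inr V)
  have h1 : f.comp (Monoid.Coprod.lift (Subgroup.zpowers u).subtype (Subgroup.zpowers v).subtype)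
      = MonoidHom.id _ := by
    apply Monoid.Coprod.hom_ext
    · ext ⟨_, k, rfl⟩
      have : (⟨u ^ k, k, rfl⟩ : Subgroup.zpowers u) = U ^ k := rfl
      simp only [this, MonoidHom.comp_apply, Monoid.Coprod.lift_apply_inl, map_zpow,
        MonoidHom.id_apply]
      exact congrArg (· ^ k) hu
    · ext ⟨_, k, rfl⟩
      have : (⟨v ^ k, k, rfl⟩ : Subgroup.zpowers v) = V ^ k := rfl
      simp only [this, MonoidHom.comp_apply, Monoid.Coprod.lift_apply_inr, map_zpow,
        MonoidHom.id_apply]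
      exact congrArg (· ^ k) hv
  have h2 : (Monoid.Coprod.lift (Subgroup.zpowers u).subtype (Subgroup.zpowers v).subtype).comp f
      = MonoidHom.id _ := by
    apply h.hom_ext
    · simp [hu, U]
    · simp [hv, V]
  exact Function.bijective_iff_has_inverse.2 ⟨f, DFunLike.congr_fun h1, DFunLike.congr_fun h2⟩

theorem IsFreeGroup.closure_range_of (G : Type*) [Group G] [IsFreeGroup G] :
    Subgroup.closure (Set.range (IsFreeGroup.of (G := G))) = ⊤ := by
  have h1 := congrArg (Subgroup.map (IsFreeGroup.mulEquiv G).toMonoidHom)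
    (FreeGroup.closure_range_of (IsFreeGroup.Generators G))
  rw [MonoidHom.map_closure, ← MonoidHom.range_eq_map,
    MonoidHom.range_eq_top.2 (IsFreeGroup.mulEquiv G).surjective, ← Set.range_comp] at h1
  exact h1

theorem IsFreeGroup.nonempty_generators {G : Type*} [Group G] [IsFreeGroup G] {H : Subgroup G}
    (h : H ≠ ⊥) : Nonempty (IsFreeGroup.Generators H) := by
  by_contra he
  rw [not_nonempty_iff] at he
  have h1 := IsFreeGroup.closure_range_of H
  rw [Set.range_eq_empty, Subgroup.closure_empty] at h1
  refine h ((Subgroup.eq_bot_iff_forall H).2 fun x hx => ?_)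
  have hx' : (⟨x, hx⟩ : H) ∈ (⊥ : Subgroup H) := h1 ▸ Subgroup.mem_top _
  exact congrArg Subtype.val (Subgroup.mem_bot.1 hx')

/-- The union of bases of the factors of a free product of free groups is a basis. -/
noncomputable def IsInternalFreeProduct.basis {G : Type} [Group G] {H K : Subgroup G}
    [IsFreeGroup H] [IsFreeGroup K] (h : IsInternalFreeProduct H K) :
    FreeGroupBasis (IsFreeGroup.Generators H ⊕ IsFreeGroup.Generators K) G :=
  FreeGroupBasis.ofUniqueLift _
    (Sum.elim (fun i => (IsFreeGroup.of i : H).1) (fun i => (IsFreeGroup.of i : K).1)) <| by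
  intro M _ f
  let e := MulEquiv.ofBijective _ h
  have hl : ∀ x : H, e (Monoid.Coprod.inl x) = x := fun x => rfl
  have hr : ∀ x : K, e (Monoid.Coprod.inr x) = x := fun x => rfl
  refine ⟨(Monoid.Coprod.lift (IsFreeGroup.lift (f ∘ Sum.inl))
    (IsFreeGroup.lift (f ∘ Sum.inr))).comp e.symm.toMonoidHom, ?_, ?_⟩
  · rintro (i | i)
    · simp [← hl]
    · simp [← hr]
  · intro F hF
    have : F.comp e.toMonoidHom = Monoid.Coprod.lift (IsFreeGroup.lift (f ∘ Sum.inl))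
        (IsFreeGroup.lift (f ∘ Sum.inr)) := by
      apply Monoid.Coprod.hom_ext
      · apply IsFreeGroup.ext_hom
        intro i
        simpa [hl] using hF (.inl i)
      · apply IsFreeGroup.ext_hom
        intro i
        simpa [hr] using hF (.inr i)
    rw [← this]
    ext x
    simp

theorem IsInternalFreeProduct.basis_apply {G : Type} [Group G] {H K : Subgroup G}
    [IsFreeGroup H] [IsFreeGroup K] (h : IsInternalFreeProduct H K)
    (x : IsFreeGroup.Generators H ⊕ IsFreeGroup.Generators K) :
    h.basis x = Sum.elim (fun i => (IsFreeGroup.of i : H).1)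
      (fun i => (IsFreeGroup.of i : K).1) x :=
  FreeGroup.lift_apply_of

theorem IsFreeGroup.eq_zpowers_of_subsingleton {G : Type*} [Group G] {H : Subgroup G}
    [IsFreeGroup H] [Subsingleton (IsFreeGroup.Generators H)] (i : IsFreeGroup.Generators H) :
    H = Subgroup.zpowers (IsFreeGroup.of i : H).1 := by
  have h1 := IsFreeGroup.closure_range_of H
  have h2 : Set.range (IsFreeGroup.of (G := H)) = {IsFreeGroup.of i} := by
    ext x
    simp only [Set.mem_range, Set.mem_singleton_iff]
    exact ⟨fun ⟨j, hj⟩ => by rw [← hj, Subsingleton.elim i j], fun h => ⟨i, h.symm⟩⟩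
  rw [h2, ← Subgroup.zpowers_eq_closure] at h1
  have h3 := congrArg (Subgroup.map H.subtype) h1
  rw [MonoidHom.map_zpowers, ← MonoidHom.range_eq_map, Subgroup.range_subtype] at h3
  exact h3.symm

theorem IsInternalFreeProduct.exists_isBasisPair {H K : Subgroup F2}
    (h : IsInternalFreeProduct H K) (hH : H ≠ ⊥) (hK : K ≠ ⊥) :
    ∃ u v : F2, IsBasisPair u v ∧ H = Subgroup.zpowers u ∧ K = Subgroup.zpowers v := by
  obtain ⟨i⟩ := IsFreeGroup.nonempty_generators hH
  obtain ⟨j⟩ := IsFreeGroup.nonempty_generators hK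
  -- Isomorphic free groups have equipotent bases, so the two factors have two generators in total,
  -- one each.
  let e : IsFreeGroup.Generators H ⊕ IsFreeGroup.Generators K ≃ Fin 2 :=
    Equiv.ofFreeGroupEquiv h.basis.repr.symm
  have hbij : Function.Bijective (![Sum.inl i, Sum.inr j] :
      Fin 2 → IsFreeGroup.Generators H ⊕ IsFreeGroup.Generators K) := by
    have : Function.Injective (![Sum.inl i, Sum.inr j] :
        Fin 2 → IsFreeGroup.Generators H ⊕ IsFreeGroup.Generators K) := by
      intro a b hab
      fin_cases a <;> fin_cases b <;> simp_all
    refine ⟨this, ?_⟩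
    have h2 := Finite.surjective_of_injective (e.injective.comp this)
    exact (e.comp_surjective _).1 h2
  have hi : Subsingleton (IsFreeGroup.Generators H) := by
    have : ∀ a, a = i := fun a => by
      obtain ⟨k, hk⟩ := hbij.2 (.inl a)
      fin_cases k
      · simpa using hk.symm
      · simp at hk
    exact ⟨fun a b => by rw [this a, this b]⟩
  have hj : Subsingleton (IsFreeGroup.Generators K) := by
    have : ∀ a, a = j := fun a => by
      obtain ⟨k, hk⟩ := hbij.2 (.inr a)
      fin_cases k
      · simp at hk
      · simpa using hk.symm
    exact ⟨fun a b => by rw [this a, this b]⟩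
  refine ⟨_, _, ⟨h.basis.reindex (Equiv.ofBijective _ hbij).symm, rfl, rfl⟩, ?_, ?_⟩
  · simpa [h.basis_apply] using IsFreeGroup.eq_zpowers_of_subsingleton i
  · simpa [h.basis_apply] using IsFreeGroup.eq_zpowers_of_subsingleton j

theorem IsBasisPair.eq_or_eq_inv_of_zpowers_eq {u v u' : F2} (h : IsBasisPair u v)
    (he : Subgroup.zpowers u' = Subgroup.zpowers u) : u' = u ∨ u' = u⁻¹ := by
  obtain ⟨k, rfl⟩ := Subgroup.mem_zpowers_iff.1 (he ▸ Subgroup.mem_zpowers u')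
  obtain ⟨l, hl⟩ := Subgroup.mem_zpowers_iff.1 (he.symm ▸ Subgroup.mem_zpowers u)
  obtain ⟨f, hu, -⟩ := h.exists_exponent 1 0
  have h1 := congrArg (fun x => (f x).toAdd) hl
  simp [hu] at h1
  rcases Int.eq_one_or_neg_one_of_mul_eq_one (mul_comm l k ▸ h1) with rfl | rfl
  · simp
  · simp

theorem IsBasisPair.zpowers_ne_of_conj {g z : F2} (h : IsBasisPair g z) :
    Subgroup.zpowers (z⁻¹ * g * z) ≠ Subgroup.zpowers g := by
  intro he
  -- Conjugating one transposition of `S₃` by another yields the third.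
  obtain ⟨f, hg, hz⟩ := h.exists_hom (Equiv.swap (0 : Fin 3) 1) (Equiv.swap (1 : Fin 3) 2)
  rcases h.eq_or_eq_inv_of_zpowers_eq he with h1 | h1
  · have := congrArg f h1
    simp only [map_mul, map_inv, hg, hz] at this
    exact absurd this (by decide)
  · have := congrArg f h1
    simp only [map_mul, map_inv, hg, hz] at this
    exact absurd this (by decide)

/-! ### Common neighbours in the graph -/

namespace AF2

/-- The vertex generated by the first element of a basis. -/
def ofBasisPair {u v : F2} (h : IsBasisPair u v) : AF2 :=
  ⟨Subgroup.zpowers u, ⟨_, h.isInternalFreeProduct⟩, by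
    rw [Ne, Subgroup.zpowers_eq_bot]; exact h.ne_one_left, fun ht =>
    h.notMem_zpowers (ht ▸ Subgroup.mem_top _)⟩

theorem adj_of_isBasisPair {x y : AF2} {u v : F2} (h : IsBasisPair u v)
    (hx : x.1 = Subgroup.zpowers u) (hy : y.1 = Subgroup.zpowers v) : graph.Adj x y := by
  refine ⟨?_, ?_⟩
  · rintro rfl
    exact h.notMem_zpowers (hx ▸ hy ▸ Subgroup.mem_zpowers v)
  · rw [hx, hy]
    exact h.isInternalFreeProduct

theorem exists_isBasisPair_of_adj {x y : AF2} (h : graph.Adj x y) :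
    ∃ u v : F2, IsBasisPair u v ∧ x.1 = Subgroup.zpowers u ∧ y.1 = Subgroup.zpowers v :=
  h.2.exists_isBasisPair x.2.2.1 y.2.2.1

theorem isBasisPair_of_adj {x y : AF2} {u v : F2} (h : graph.Adj x y)
    (hx : x.1 = Subgroup.zpowers u) (hy : y.1 = Subgroup.zpowers v) : IsBasisPair u v := by
  obtain ⟨u', v', h', hx', hy'⟩ := exists_isBasisPair_of_adj h
  have h1 := h'.eq_or_eq_inv_of_zpowers_eq (hx.symm.trans hx')
  have h2 := h'.symm.eq_or_eq_inv_of_zpowers_eq (hy.symm.trans hy')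
  rcases h1 with rfl | rfl <;> rcases h2 with rfl | rfl
  · exact h'
  · exact h'.inv_right
  · exact h'.inv_left
  · exact h'.inv_left.inv_right

theorem exists_eq_zpowers_of_adj {x y : AF2} {u v : F2} (h : IsBasisPair u v)
    (hx : x.1 = Subgroup.zpowers u) (hxy : graph.Adj x y) :
    ∃ i j : ℤ, y.1 = Subgroup.zpowers (u ^ i * v * u ^ j) := by
  obtain ⟨-, w, -, -, hy⟩ := exists_isBasisPair_of_adj hxy
  obtain ⟨i, j, ε, rfl | rfl, rfl⟩ := h.exists_eq_zpow_mul_zpow (isBasisPair_of_adj hxy hx hy)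
  · exact ⟨i, j, by simpa using hy⟩
  · refine ⟨-j, -i, ?_⟩
    rw [hy, ← Subgroup.zpowers_inv]
    congr 1
    group

theorem mem_D_one_inter {x y v : AF2} :
    v ∈ D 1 x ∩ D 1 y ↔ graph.Adj x v ∧ graph.Adj y v := by
  simp [D]

theorem eq_zpowers_of_adj_of_conj {x y v : AF2} {a b : F2} (h : IsBasisPair a b) {m : ℤ}
    (hm : 2 ≤ |m|) (hx : x.1 = Subgroup.zpowers a)
    (hy : y.1 = Subgroup.zpowers (b ^ m * a * b ^ (-m))) (hxv : graph.Adj x v)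
    (hyv : graph.Adj y v) : v.1 = Subgroup.zpowers b := by
  obtain ⟨p, q, hv⟩ := exists_eq_zpowers_of_adj h hx hxv
  have h1 := (isBasisPair_of_adj hyv hy hv).conj (b ^ (-m))
  have h2 : b ^ (-m) * (b ^ m * a * b ^ (-m)) * (b ^ (-m))⁻¹ = a := by group
  have h3 : (b ^ (-m))⁻¹ = b ^ m := by group
  rw [h2, h3] at h1
  obtain ⟨i, j, ε, hε, h4⟩ := h.exists_eq_zpow_mul_zpow h1
  obtain ⟨rfl, rfl⟩ := h.eq_zero_of_zpow_conj_eq hε hm h4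
  simpa using hv

/-- Conjugation by `a ^ (-d)` carries `v` to `⟨b⟩`, turning adjacency into the equation of
`eq_zero_or_of_zpow_conj_eq`. -/
theorem exponent_of_adj_conj {y v : AF2} {a b : F2} (h : IsBasisPair a b) {m n d : ℤ}
    (hmn : m + n ≠ 0) (hy : y.1 = Subgroup.zpowers (b ^ m * a * b ^ n)) (hyv : graph.Adj y v)
    (hv : v.1 = Subgroup.zpowers (a ^ d * b * a ^ (-d))) :
    d = 0 ∨ (d = 1 ∧ m = 0) ∨ (d = -1 ∧ n = 0) := by
  have h1 := ((isBasisPair_of_adj hyv hy hv).conj (a ^ (-d))).symm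
  have h2 : a ^ (-d) * (a ^ d * b * a ^ (-d)) * (a ^ (-d))⁻¹ = b := by group
  have h3 : (a ^ (-d))⁻¹ = a ^ d := by group
  rw [h2, h3] at h1
  obtain ⟨i, j, ε, -, h4⟩ := h.symm.exists_eq_zpow_mul_zpow h1
  obtain ⟨f, fa, fb⟩ := h.exists_exponent 1 0
  have h5 := congrArg (fun x => (f x).toAdd) h4
  simp [fa, fb] at h5
  subst h5
  rw [zpow_one] at h4
  exact h.eq_zero_or_of_zpow_conj_eq hmn h4

theorem exists_pair_of_adj_conj {y : AF2} {a b : F2} (h : IsBasisPair a b) {m n : ℤ}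
    (hmn : m + n ≠ 0) (hy : y.1 = Subgroup.zpowers (b ^ m * a * b ^ n)) :
    ∃ s t : Subgroup F2, ∀ (v : AF2) (d : ℤ), graph.Adj y v →
      v.1 = Subgroup.zpowers (a ^ d * b * a ^ (-d)) → v.1 = s ∨ v.1 = t := by
  by_cases hm : m = 0
  · refine ⟨Subgroup.zpowers b, Subgroup.zpowers (a * b * a⁻¹), fun v d hyv hv => ?_⟩
    rcases exponent_of_adj_conj h hmn hy hyv hv with rfl | ⟨rfl, -⟩ | ⟨-, hn⟩
    · left; simpa using hv
    · right; simpa using hv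
    · omega
  · refine ⟨Subgroup.zpowers b, Subgroup.zpowers (a⁻¹ * b * a), fun v d hyv hv => ?_⟩
    rcases exponent_of_adj_conj h hmn hy hyv hv with rfl | ⟨-, hm'⟩ | ⟨rfl, -⟩
    · left; simpa using hv
    · exact absurd hm' hm
    · right; simpa using hv

/-- The abelianized pair of generators has determinant `1 - (p + q) * (m + n)` up to sign, and this
must be `±1`. -/
theorem exponent_sum_mul_of_adj {y v : AF2} {a b : F2} (h : IsBasisPair a b) {m n p q : ℤ}
    (hy : y.1 = Subgroup.zpowers (b ^ m * a * b ^ n)) (hyv : graph.Adj y v)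
    (hv : v.1 = Subgroup.zpowers (a ^ p * b * a ^ q)) :
    (p + q) * (m + n) = 0 ∨ (p + q) * (m + n) = 2 := by
  have h1 := isBasisPair_of_adj hyv hy hv
  obtain ⟨i, j, ε, hε, h2⟩ := (h.symm.zpow_mul_zpow m n).symm.exists_eq_zpow_mul_zpow h1
  obtain ⟨f, fa, fb⟩ := h.exists_exponent 1 0
  obtain ⟨g, ga, gb⟩ := h.exists_exponent 0 1
  have h3 := congrArg (fun x => (f x).toAdd) h2
  have h4 := congrArg (fun x => (g x).toAdd) h2
  simp [fa, fb] at h3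
  simp [ga, gb] at h4
  rw [h3]
  have h5 : (i + j) * (m + n) = 1 - ε := by linear_combination -h4
  rw [h5]
  rcases hε with rfl | rfl
  · left; rfl
  · right; rfl

theorem exists_four_of_adj {x y : AF2} {a b : F2} (h : IsBasisPair a b) {m n : ℤ}
    (hmn : m + n ≠ 0) (hx : x.1 = Subgroup.zpowers a)
    (hy : y.1 = Subgroup.zpowers (b ^ m * a * b ^ n)) :
    ∃ s t s' t' : Subgroup F2, ∀ v : AF2, graph.Adj x v → graph.Adj y v →
      v.1 = s ∨ v.1 = t ∨ v.1 = s' ∨ v.1 = t' := by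
  obtain ⟨s, t, hst⟩ := exists_pair_of_adj_conj h hmn hy
  by_cases hN : ∃ (v : AF2) (p q : ℤ), graph.Adj y v ∧
      v.1 = Subgroup.zpowers (a ^ p * b * a ^ q) ∧ (p + q) * (m + n) = 2
  · obtain ⟨v₁, p, q, hyv₁, hv₁, hpq⟩ := hN
    -- Replacing `b` by the generator of `v₁` turns the common neighbours with product `2` into
    -- conjugates of the new `b` by powers of `a`.
    have h' := h.zpow_mul_zpow p q
    obtain ⟨m', n', hy'⟩ := exists_eq_zpowers_of_adj h'.symm hv₁ hyv₁.symm
    have hmn' : m' + n' ≠ 0 := by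
      obtain ⟨g, ga, gb⟩ := h.exists_exponent 0 1
      rcases (h.symm.zpow_mul_zpow m n).symm.eq_or_eq_inv_of_zpowers_eq (hy'.symm.trans hy)
        with h1 | h1
      · have h2 := congrArg (fun x => (g x).toAdd) h1
        simp [ga, gb] at h2
        omega
      · have h2 := congrArg (fun x => (g x).toAdd) h1
        simp [ga, gb] at h2
        omega
    obtain ⟨s', t', hst'⟩ := exists_pair_of_adj_conj h' hmn' hy'
    refine ⟨s, t, s', t', fun v hxv hyv => ?_⟩
    obtain ⟨i, j, hv⟩ := exists_eq_zpowers_of_adj h hx hxv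
    rcases exponent_sum_mul_of_adj h hy hyv hv with h0 | h2
    · obtain rfl : j = -i := by
        have := (mul_eq_zero.1 h0).resolve_right hmn
        omega
      exact (hst v i hyv hv).imp_right .inl
    · obtain rfl : j = p + q - i := by
        have := mul_right_cancel₀ hmn (h2.trans hpq.symm)
        omega
      refine .inr (.inr (hst' v (i - p) hyv ?_))
      rw [hv]
      congr 1
      group
  · refine ⟨s, t, s, t, fun v hxv hyv => ?_⟩
    obtain ⟨i, j, hv⟩ := exists_eq_zpowers_of_adj h hx hxv
    rcases exponent_sum_mul_of_adj h hy hyv hv with h0 | h2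
    · obtain rfl : j = -i := by
        have := (mul_eq_zero.1 h0).resolve_right hmn
        omega
      exact (hst v i hyv hv).imp_right .inl
    · exact absurd ⟨v, i, j, hyv, hv, h2⟩ hN

theorem C_of_isBasisPair {x y : AF2} {g z : F2} (h : IsBasisPair g z)
    (hx : x.1 = Subgroup.zpowers g) (hy : y.1 = Subgroup.zpowers (z⁻¹ * g * z)) : C x y := by
  obtain ⟨b, rfl, rfl⟩ := h
  exact ⟨b, hx, hy⟩

theorem encard_le_four_of_not_C {x y : AF2} (hxy : x ≠ y) (hC : ¬ C x y) :
    (D 1 x ∩ D 1 y).encard ≤ 4 := by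
  suffices hs : ∃ s t s' t' : Subgroup F2, ∀ v : AF2, graph.Adj x v → graph.Adj y v →
      v.1 = s ∨ v.1 = t ∨ v.1 = s' ∨ v.1 = t' by
    obtain ⟨s, t, s', t', hs⟩ := hs
    have hinj : Function.Injective (fun v : AF2 => v.1) := Subtype.val_injective
    rw [← hinj.encard_image (D 1 x ∩ D 1 y)]
    refine (Set.encard_le_encard (t := {s, t, s', t'}) ?_).trans ?_
    · rintro _ ⟨v, hv, rfl⟩
      rw [mem_D_one_inter] at hv
      exact hs v hv.1 hv.2
    · refine (Set.encard_insert_le _ _).trans ?_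
      refine (add_le_add_left (Set.encard_insert_le _ _) 1).trans ?_
      refine (add_le_add_left (add_le_add_left ((Set.encard_insert_le _ _).trans
        (add_le_add_left (Set.encard_singleton _).le 1)) 1) 1).trans ?_
      norm_num
  by_cases hN : ∃ v₀ : AF2, graph.Adj x v₀ ∧ graph.Adj y v₀
  · obtain ⟨v₀, hx₀, hy₀⟩ := hN
    obtain ⟨a, b, h, hx, hv₀⟩ := exists_isBasisPair_of_adj hx₀
    obtain ⟨m, n, hy⟩ := exists_eq_zpowers_of_adj h.symm hv₀ hy₀.symm
    by_cases hmn : m + n = 0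
    · obtain rfl : n = -m := by omega
      by_cases hm : 2 ≤ |m|
      · exact ⟨Subgroup.zpowers b, ⊥, ⊥, ⊥, fun v hxv hyv =>
          .inl (eq_zpowers_of_adj_of_conj h hm hx hy hxv hyv)⟩
      · have : m = 0 ∨ m = 1 ∨ m = -1 := by
          rw [not_le, abs_lt] at hm
          omega
        rcases this with rfl | rfl | rfl
        · exact absurd (Subtype.ext (by rw [hx, hy]; simp)) hxy
        · exact absurd (C_of_isBasisPair h.inv_right hx (by simpa using hy)) hC
        · exact absurd (C_of_isBasisPair h hx (by simpa using hy)) hC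
    · exact exists_four_of_adj h hmn hx hy
  · exact ⟨⊥, ⊥, ⊥, ⊥, fun v hxv hyv => absurd ⟨v, hxv, hyv⟩ hN⟩

theorem infinite_of_C {x y : AF2} (hC : C x y) : (D 1 x ∩ D 1 y).Infinite := by
  obtain ⟨b, hx, hy⟩ := hC
  have h : IsBasisPair (b 0) (b 1) := ⟨b, rfl, rfl⟩
  revert hx hy h
  generalize b 0 = g
  generalize b 1 = z
  intro hx hy h
  refine Set.infinite_of_injective_forall_mem
    (f := fun n : ℤ => ofBasisPair (h.zpow_mul_zpow n 0).symm) ?_ ?_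
  -- The exponent of `g` separates the values of `n`; that of `z` excludes inverse generators.
  · intro n n' hn
    obtain ⟨f, fg, fz⟩ := h.exists_exponent 1 0
    obtain ⟨f', fg', fz'⟩ := h.exists_exponent 0 1
    rcases (h.zpow_mul_zpow n' 0).symm.eq_or_eq_inv_of_zpowers_eq (congrArg Subtype.val hn)
      with h1 | h1
    · simpa [fg, fz] using congrArg (fun x => (f x).toAdd) h1
    · have := congrArg (fun x => (f' x).toAdd) h1
      simp [fg', fz'] at this
  · intro n
    rw [mem_D_one_inter]
    refine ⟨adj_of_isBasisPair (h.zpow_mul_zpow n 0) hx rfl, ?_⟩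
    have h1 := (h.conj z⁻¹).zpow_mul_zpow 0 n
    refine adj_of_isBasisPair h1 (by rw [hy, inv_inv]) ?_
    change Subgroup.zpowers _ = _
    congr 1
    simp only [conj_zpow]
    group

theorem ne_of_C {x y : AF2} (hC : C x y) : x ≠ y := by
  rintro rfl
  obtain ⟨b, hx, hy⟩ := hC
  exact IsBasisPair.zpowers_ne_of_conj ⟨b, rfl, rfl⟩ (hy.symm.trans hx)

theorem five_le_encard_iff {x y : AF2} (hxy : x ≠ y) :
    5 ≤ (D 1 x ∩ D 1 y).encard ↔ C x y := by
  refine ⟨fun h => ?_, fun h => ?_⟩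
  · by_contra hC
    exact absurd (h.trans (encard_le_four_of_not_C hxy hC)) (by decide)
  · rw [(infinite_of_C h).encard_eq]
    exact le_top

end AF2

/-! ### First-order definability -/

theorem Set.natCast_le_encard_iff_exists_injective {α : Type*} {s : Set α} {n : ℕ} :
    (n : ℕ∞) ≤ s.encard ↔ ∃ f : Fin n → α, Function.Injective f ∧ ∀ i, f i ∈ s := by
  constructor
  · intro h
    obtain ⟨t, hts, ht⟩ := Set.exists_subset_encard_eq h
    have hfin : t.Finite := Set.finite_of_encard_eq_coe ht
    have hc : Nat.card t = n := by
      rw [Nat.card_coe_set_eq, Set.ncard, ht]; rfl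
    have := hfin.to_subtype
    let e := Finite.equivFinOfCardEq hc
    exact ⟨fun i => e.symm i, Subtype.val_injective.comp e.symm.injective,
      fun i => hts (e.symm i).2⟩
  · rintro ⟨f, hf, hs⟩
    have h1 : (Set.range f).encard = n := by
      rw [← Set.image_univ, hf.encard_image]
      simp
    rw [← h1]
    exact Set.encard_le_encard (Set.range_subset_iff.2 hs)

open FirstOrder FirstOrder.Language in
/-- In the language of graphs: the two free variables denote distinct vertices with at least five
common neighbours. -/
noncomputable def fiveCommonNeighborsFormula : Language.graph.Formula (Fin 2) :=
  -- Equality has to be excluded: a vertex has infinitely many neighbours in common with itself.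
  (∼ (Term.equal (Term.var 0) (Term.var 1))) ⊓
    BoundedFormula.exs (n := 5)
      (BoundedFormula.iInf (fun i : Fin 5 =>
          adj.boundedFormula₂ (Term.var (Sum.inl 0)) (Term.var (Sum.inr i)) ⊓
            adj.boundedFormula₂ (Term.var (Sum.inl 1)) (Term.var (Sum.inr i))) ⊓
        BoundedFormula.iInf (fun p : {p : Fin 5 × Fin 5 // p.1 ≠ p.2} =>
          ∼ (Term.bdEqual (Term.var (Sum.inr p.1.1)) (Term.var (Sum.inr p.1.2)))))

theorem realize_fiveCommonNeighborsFormula (v : Fin 2 → AF2) :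
    fiveCommonNeighborsFormula.Realize v ↔
      v 0 ≠ v 1 ∧ 5 ≤ (AF2.D 1 (v 0) ∩ AF2.D 1 (v 1)).encard := by
  have h5 : (5 : ℕ∞) = ((5 : ℕ) : ℕ∞) := rfl
  have hrel : ∀ x y : AF2, FirstOrder.Language.Structure.RelMap FirstOrder.Language.adj ![x, y] ↔
    AF2.graph.Adj x y := fun x y => Iff.rfl
  rw [h5, Set.natCast_le_encard_iff_exists_injective, fiveCommonNeighborsFormula,
    FirstOrder.Language.Formula.realize_inf, FirstOrder.Language.Formula.realize_not,
    FirstOrder.Language.Formula.realize_equal, FirstOrder.Language.BoundedFormula.realize_exs]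
  simp only [FirstOrder.Language.Term.realize_var, FirstOrder.Language.BoundedFormula.realize_inf,
    FirstOrder.Language.BoundedFormula.realize_iInf, FirstOrder.Language.BoundedFormula.realize_not,
    FirstOrder.Language.BoundedFormula.realize_bdEqual,
    FirstOrder.Language.BoundedFormula.realize_rel₂, Sum.elim_inl, Sum.elim_inr, hrel,
    AF2.mem_D_one_inter, Subtype.forall, Prod.forall]
  refine and_congr_right fun _ => exists_congr fun f => ?_
  rw [and_comm]
  exact and_congr_left fun _ => ⟨fun h i j hij => by_contra fun hne => h i j hne hij,
    fun h i j hne hij => hne (h hij)⟩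

theorem mainTheorem7 :
    (∀ x y : AF2, x ≠ y →
      List.TFAE [
        AF2.C x y,
        (AF2.D 1 x ∩ AF2.D 1 y).Infinite,
        5 ≤ (AF2.D 1 x ∩ AF2.D 1 y).encard]) ∧
    Set.Definable₂ (∅ : Set AF2) FirstOrder.Language.graph
      {p : AF2 × AF2 | AF2.C p.1 p.2} := by
  refine ⟨fun x y hxy => ?_, ?_⟩
  · tfae_have 1 → 2 := AF2.infinite_of_C
    tfae_have 2 → 3 := fun h => by rw [h.encard_eq]; exact le_top
    tfae_have 3 → 1 := (AF2.five_le_encard_iff hxy).1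
    tfae_finish
  · refine Set.empty_definable_iff.2 ⟨fiveCommonNeighborsFormula, ?_⟩
    ext v
    rw [Set.mem_ofPred_eq, Set.mem_ofPred_eq, Set.mem_ofPred_eq, realize_fiveCommonNeighborsFormula]
    exact ⟨fun h => ⟨AF2.ne_of_C h, (AF2.five_le_encard_iff (AF2.ne_of_C h)).2 h⟩,
      fun h => (AF2.five_le_encard_iff h.1).1 h.2⟩
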